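/- Consider noiseless non-adaptive group testing with $n$ items, of which a uniformly random set $\mathcal D$ of $c$ items is defective, and with $\ell$ tests. A \emph{simple group testing algorithm} works as follows. A bias vector $\vec P\in[0,1]^\ell$ is drawn from an arbitrary probability distribution (possibly depending on $n,c,\ell$), together with any additional random bits for the decoder. Given these, item $j$ is included in test $i$ with probability $P_i$ (written $X_{j,i}=1$), independently over all $i$ and $j$, and independently of $\mathcal D$. The outcome $Y_i$ of test $i$ is $1$ if and only if $X_{j,i}=1$ for some $j\in\mathcal D$. For each item $j$ the decoder decides whether to declare $j$ defective on the basis of $j$, its own row $\vec X_j$, the outcomes $\vec Y$, the bias vector $\vec P$ and the additional random bits only (not on the rows of other items). Let $\hat{\mathcal D}$ be the set of items declared defective. Then any simple group testing algorithm for $c$ defectives and $n$ items asymptotically requires at least $\ell\sim\frac{c\ln n}{(\ln 2)^2}\approx 2.08\,c\ln n$ tests. Precisely, for all $\delta>0$ and $\varepsilon\in(0,1)$: 1. (finding all defectives) there is $c_0=c_0(\delta,\varepsilon)$ such that for all $c\ge c_0$ and all $n\ge 2c$, every simple group testing algorithm with $\mathbb P(\hat{\mathcal D}=\mathcal D)\ge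 1-\varepsilon$ uses $\ell\ge(1-\delta)\frac{c\ln n}{(\ln 2)^2}$ tests; 2. (finding at least one defective, without false positives) there are $c_0$ and $K$, depending only on $\delta$ and $\varepsilon$, such that for all $c\ge c_0$ and all $n\ge c^{K}$, every simple group testing algorithm with $\mathbb P(\emptyset\ne\hat{\mathcal D}\subseteq\mathcal D)\ge 1-\varepsilon$ uses $\ell\ge(1-\delta)\frac{c\ln n}{(\ln 2)^2}$ tests. Moreover $\left|\frac{1}{(\ln 2)^2}-2.08\right|<0.005$. -/

import Mathlib

/-- A simple-decoder (non-adaptive, noiseless) group testing algorithm with a bias-based encoder,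
for `n` items and `ℓ` tests. The seed `ω` is the information shared by encoder and decoder: it
determines the vector `bias ω` of inclusion probabilities of the `ℓ` tests, and it may contain
further random bits for the decoder. (For i.i.d. biases take `Seed = [0,1]^ℓ` with a product law
and `bias = id`.) Given the seed, item `j` takes part in test `i` with probability `bias ω i`,
independently over all items and tests. The decision whether to declare item `j` defective is a
function of the seed, the row `X j` of that item alone, and the vector of test outcomes. -/
structure SimpleGroupTesting (n ℓ : ℕ) where
  Seed : Type
  [measurableSpace : MeasurableSpace Seed]
  law : MeasureTheory.Measure Seed
  [isProbabilityMeasure : MeasureTheory.IsProbabilityMeasure law]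
  bias : Seed → Fin ℓ → unitInterval
  measurable_bias : Measurable bias
  accuse : Seed → Fin n → (Fin ℓ → Bool) → (Fin ℓ → Bool) → Bool
  measurable_accuse : ∀ j x y, Measurable fun ω => accuse ω j x y

/-- The outcomes of the tests: test `i` is positive iff it contains a defective item. -/
def testOutcome {n ℓ : ℕ} (D : Finset (Fin n)) (X : Fin n → Fin ℓ → Bool) : Fin ℓ → Bool :=
  fun i => decide (∃ j ∈ D, X j i = true)

/-- The probability of the test design `X` when item `j` is put into test `i` with probability
`p i`, independently over all `i` and `j`. -/
noncomputable def designProb {n ℓ : ℕ} (p : Fin ℓ → unitInterval) (X : Fin n → Fin ℓ → Bool) : ℝ :=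
  ∏ j, ∏ i, if X j i = true then (p i : ℝ) else 1 - (p i : ℝ)

namespace SimpleGroupTesting

variable {n ℓ : ℕ}

/-- The set of items declared defective, given the seed, the design and the test outcomes. -/
def accused (S : SimpleGroupTesting n ℓ) (ω : S.Seed) (X : Fin n → Fin ℓ → Bool)
    (y : Fin ℓ → Bool) : Finset (Fin n) :=
  Finset.univ.filter fun j => S.accuse ω j (X j) y = true

/-- The probability that `Win D A` holds for the set `D` of defectives and the set `A` of items
declared defective, when `D` is a uniformly random set of `c` items, independent of the seed and of
the design. -/
noncomputable def winProb (S : SimpleGroupTesting n ℓ) (c : ℕ)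
    (Win : Finset (Fin n) → Finset (Fin n) → Prop) [∀ D A, Decidable (Win D A)] : ℝ :=
  letI := S.measurableSpace
  ∫ ω, (∑ D ∈ Finset.powersetCard c Finset.univ, ∑ X : Fin n → Fin ℓ → Bool,
      designProb (S.bias ω) X *
        (if Win D (S.accused ω X (testOutcome D X)) then 1 else 0)) / (n.choose c : ℝ) ∂S.law

/-- The probability that the items declared defective are exactly the `c` defectives. -/
noncomputable def probFindAll (S : SimpleGroupTesting n ℓ) (c : ℕ) : ℝ :=
  S.winProb c fun D A => A = D

/-- The probability that at least one item is declared defective and that all the items declared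
defective are indeed defective. -/
noncomputable def probFindSome (S : SimpleGroupTesting n ℓ) (c : ℕ) : ℝ :=
  S.winProb c fun D A => A.Nonempty ∧ A ⊆ D

end SimpleGroupTesting

/-! Fix the seed and put c = m + 1. A simple decoder judges an item by its row and the outcomes.
This pair has one joint law if the item is defective and the product of its marginals if not, and
only the likelihood ratio of the two separates the cases. If a test is negative with probability u =
(1 - p)^c, then p c ≤ -log u, and a positive test containing the item has ratio 1 / (1 - u). So one
test yields at most about log u · log (1 - u) / c ≤ (log 2)² / c of information
(`log_mul_log_one_sub_le`). `likelihoodMoment_le` makes this a bound on small moments of the ratio,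
uniform in the bias. By a Chernoff bound (`sum_rowOutcomesProb_le`), with fewer than (1 - δ) c log n
/ (log 2)² tests the ratio rarely exceeds n^(1 - δ²/2).

On the other side, given the outcomes the rows of non-defective items are independent. Avoiding
false positives therefore forces the conditional expected number of false alarms to be bounded,
except on an event of small probability (`no_false_positive_le`). Averaged over the defective set,
an item is then falsely accused with probability O(1/n), and the change of measure shows that a
defective item is accused with probability O(n^(-γ)) (`sum_true_positive_le`,
`exists_error_exponent`). So O(c n^(-γ)) true positives are expected: a vanishing fraction of c, and
itself vanishing once n is a large power of c. -/

/-! ### Elementary inequalities for logarithms and powers -/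

-- The difference of the two sides is concave on [0, 1/2], because x (1 - x) increases there, and it
-- vanishes at both endpoints.
open Real in
theorem mul_log_le_one_sub_mul_log {u : ℝ} (h0 : 0 ≤ u) (h1 : u ≤ 1 / 2) :
    u * log u ≤ (1 - u) * log (1 - u) := by
  have hcont : Continuous fun x : ℝ => (1 - x) * log (1 - x) - x * log x :=
    (continuous_mul_log.comp (continuous_const.sub continuous_id)).sub continuous_mul_log
  have hd : ∀ x ∈ Set.Ioo (0 : ℝ) (1 / 2), HasDerivAt
      (fun x : ℝ => (1 - x) * log (1 - x) - x * log x) (-(log (1 - x) + 1) - (log x + 1)) x := by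
    intro x hx
    have hx0 : x ≠ 0 := hx.1.ne'
    have hx1 : 1 - x ≠ 0 := by linarith [hx.2]
    have h := (hasDerivAt_mul_log hx1).comp x ((hasDerivAt_id x).const_sub 1)
    refine (h.sub (hasDerivAt_mul_log hx0)).congr_deriv ?_
    simp
  have hconc : ConcaveOn ℝ (Set.Icc (0 : ℝ) (1 / 2))
      fun x : ℝ => (1 - x) * log (1 - x) - x * log x := by
    apply AntitoneOn.concaveOn_of_deriv (convex_Icc _ _) hcont.continuousOn
    · rw [interior_Icc]
      exact fun x hx => (hd x hx).differentiableAt.differentiableWithinAt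
    · rw [interior_Icc]
      intro x hx y hy hxy
      rw [(hd x hx).deriv, (hd y hy).deriv]
      have hxp := hx.1
      have hyp := hy.1
      have hx2 := hx.2
      have hy2 := hy.2
      have key : log (x * (1 - x)) ≤ log (y * (1 - y)) := by
        apply log_le_log
        · exact mul_pos hxp (by linarith)
        · nlinarith
      rw [log_mul hxp.ne' (by linarith), log_mul hyp.ne' (by linarith)] at key
      linarith
  have h := hconc.2 (Set.left_mem_Icc.2 (by norm_num)) (Set.right_mem_Icc.2 (by norm_num))
    (show 0 ≤ 1 - 2 * u by linarith) (show 0 ≤ 2 * u by linarith) (by ring)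
  norm_num at h
  rw [show 2 * u * (1 / 2) = u by ring] at h
  exact h

-- The source of the constant: the product is symmetric about 1/2 and increasing before it, the sign
-- of the derivative being `mul_log_le_one_sub_mul_log`.
open Real in
theorem log_mul_log_one_sub_le {u : ℝ} (h0 : 0 < u) (h1 : u < 1) :
    log u * log (1 - u) ≤ log 2 ^ 2 := by
  have half : ∀ u : ℝ, 0 < u → u ≤ 1 / 2 → log u * log (1 - u) ≤ log 2 ^ 2 := by
    intro u h0 h1
    have hd : ∀ x ∈ Set.Icc u (1 / 2), HasDerivAt (fun x : ℝ => log x * log (1 - x))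
        (x⁻¹ * log (1 - x) + log x * (-1 / (1 - x))) x := by
      intro x hx
      have hx0 : x ≠ 0 := (h0.trans_le hx.1).ne'
      have hx1 : 1 - x ≠ 0 := by linarith [hx.2]
      exact (hasDerivAt_log hx0).mul (((hasDerivAt_id x).const_sub 1).log hx1)
    have hmono : MonotoneOn (fun x : ℝ => log x * log (1 - x)) (Set.Icc u (1 / 2)) := by
      apply monotoneOn_of_deriv_nonneg (convex_Icc _ _)
      · exact fun x hx => (hd x hx).continuousAt.continuousWithinAt
      · intro x hx
        exact (hd x (interior_subset hx)).differentiableAt.differentiableWithinAt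
      · intro x hx
        have hx := interior_subset hx
        rw [(hd x hx).deriv]
        have hxp : 0 < x := h0.trans_le hx.1
        have hx2 : 0 < 1 - x := by linarith [hx.2]
        have h := mul_log_le_one_sub_mul_log hxp.le hx.2
        have : x⁻¹ * log (1 - x) + log x * (-1 / (1 - x)) =
            ((1 - x) * log (1 - x) - x * log x) / (x * (1 - x)) := by
          field_simp
          ring
        rw [this]
        exact div_nonneg (by linarith) (by positivity)
    have h := hmono (Set.left_mem_Icc.2 h1) (Set.right_mem_Icc.2 h1) h1
    have h2 : log (1 / 2) * log (1 - 1 / 2) = log 2 ^ 2 := by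
      norm_num
      rw [show (1 / 2 : ℝ) = 2⁻¹ by norm_num, log_inv]
      ring
    simp only at h
    linarith
  rcases le_total u (1 / 2) with h | h
  · exact half u h0 h
  · have := half (1 - u) (by linarith) (by linarith)
    rw [sub_sub_cancel, mul_comm] at this
    exact this

-- Controls the second-order term in `positive_term_le`, uniformly in the bias.
open Real in
theorem neg_log_mul_log_one_sub_sq_mul_exp_le {u : ℝ} (h0 : 0 < u) (h1 : u < 1) :
    -log u * (log (1 - u)) ^ 2 * exp (-log (1 - u) / 2) ≤ 32 := by
  set w := -log (1 - u) with hw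
  have hw0 : 0 ≤ w := by
    have := log_nonpos (x := 1 - u) (by linarith) (by linarith)
    linarith
  have ha0 : 0 ≤ -log u := by
    have := log_nonpos h0.le h1.le
    linarith
  have hsq : (log (1 - u)) ^ 2 = w ^ 2 := by rw [hw]; ring
  have hexp : exp (-w) = 1 - u := by
    rw [hw, neg_neg, exp_log (by linarith)]
  rw [hsq]
  rcases le_total u (1 / 2) with h | h
  · have hlog2 : log 2 ≤ 1 := by linarith [log_two_lt_d9]
    have hlog2' : 0 ≤ log 2 := by linarith [log_two_gt_d9]
    have haw : -log u * w ≤ 1 := by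
      have := log_mul_log_one_sub_le h0 h1
      have e : -log u * w = log u * log (1 - u) := by rw [hw]; ring
      rw [e]
      nlinarith
    have hw1 : w ≤ 1 := by
      have : log (1 / 2) ≤ log (1 - u) := log_le_log (by norm_num) (by linarith)
      rw [one_div, log_inv] at this
      linarith
    have he : exp (w / 2) ≤ 3 := by
      calc exp (w / 2) ≤ exp 1 := exp_le_exp.2 (by linarith)
        _ ≤ 3 := by linarith [exp_one_lt_d9]
    calc -log u * w ^ 2 * exp (w / 2) = (-log u * w) * w * exp (w / 2) := by ring
      _ ≤ 1 * 1 * 3 := by gcongr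
      _ ≤ 32 := by norm_num
  -- As u tends to 1, -log u decays like 1 - u = exp (-w), which absorbs both w² ≤ 16 exp (w/2) and
  -- the remaining exp (w/2).
  · have ha : -log u ≤ 2 * exp (-w) := by
      rw [hexp]
      have := log_le_sub_one_of_pos (inv_pos.2 h0)
      rw [log_inv] at this
      have h3 : u⁻¹ - 1 ≤ 2 * (1 - u) := by
        rw [inv_eq_one_div, div_sub_one h0.ne', div_le_iff₀ h0]
        nlinarith
      linarith
    have hq : w ^ 2 ≤ 16 * exp (w / 2) := by
      have h4 : w / 4 ≤ exp (w / 4) := by linarith [add_one_le_exp (w / 4)]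
      have : exp (w / 2) = exp (w / 4) ^ 2 := by rw [← exp_nat_mul]; congr 1; push_cast; ring
      rw [this]
      nlinarith [pow_le_pow_left₀ (by positivity) h4 2]
    calc -log u * w ^ 2 * exp (w / 2)
        ≤ (2 * exp (-w)) * (16 * exp (w / 2)) * exp (w / 2) := by gcongr
      _ = 32 * exp (-w + w / 2 + w / 2) := by rw [exp_add, exp_add]; ring
      _ = 32 := by
        rw [show -w + w / 2 + w / 2 = 0 by ring]
        norm_num

theorem Real.exp_sub_one_le_add_sq_mul_exp {x : ℝ} (hx : 0 ≤ x) :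
    Real.exp x - 1 ≤ x + x ^ 2 * Real.exp x := by
  have h : Real.exp x - 1 ≤ x * Real.exp x := by
    have h1 := Real.add_one_le_exp (-x)
    have h2 : Real.exp (-x) * Real.exp x = 1 := by rw [← Real.exp_add]; simp
    nlinarith [Real.exp_pos x]
  nlinarith

/-- In the geometric sum 1 + q + ... + q^m each of the m + 1 terms is at least q^m. -/
theorem succ_mul_one_sub_mul_pow_le {q : ℝ} (h0 : 0 ≤ q) (h1 : q ≤ 1) (m : ℕ) :
    (m + 1 : ℝ) * ((1 - q) * q ^ m) ≤ 1 - q ^ (m + 1) := by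
  induction m with
  | zero => simp
  | succ m ih =>
    have hm : (0 : ℝ) ≤ q ^ m := pow_nonneg h0 m
    push_cast
    have hle : (1 - q) * q ^ (m + 1) ≤ 1 - q :=
      mul_le_of_le_one_right (by linarith) (pow_le_one₀ h0 h1)
    have := mul_le_mul_of_nonneg_left ih h0
    rw [pow_succ q (m + 1)]
    rw [pow_succ q m] at *
    linarith

/-! ### Likelihood ratio of a single test -/

namespace GroupTesting

/-- The law of the participation of an item in a test with bias `p`. -/
noncomputable def itemProb (p : ℝ) (x : Bool) : ℝ := if x = true then p else 1 - p

/-- The law of the outcome of a test with bias `p` on `m` defectives. -/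
noncomputable def outcomeProb (p : ℝ) (m : ℕ) (y : Bool) : ℝ :=
  if y = true then 1 - (1 - p) ^ m else (1 - p) ^ m

/-- The law of the outcome of a test with bias `p`, given the participation `x` of one defective
among `m + 1`. -/
noncomputable def condOutcomeProb (p : ℝ) (m : ℕ) (x y : Bool) : ℝ :=
  if x = true then (if y = true then 1 else 0) else outcomeProb p m y

/-- The joint law of the participation of a defective and the test outcome, with `m` further
defectives. -/
noncomputable def jointProb (p : ℝ) (m : ℕ) (x y : Bool) : ℝ :=
  itemProb p x * condOutcomeProb p m x y

/-- The `s`-th moment of the likelihood ratio of a single test, under the law of a defective. -/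
noncomputable def likelihoodMoment (p : ℝ) (m : ℕ) (s : ℝ) : ℝ :=
  ∑ x, ∑ y, jointProb p m x y * (jointProb p m x y / (itemProb p x * outcomeProb p (m + 1) y)) ^ s

/-- The item is in the test, which is then positive. This is the only contribution of order 1 / (m +
1): expand exp (s w) to second order and multiply by (1 - q) (m + 1) ≤ -log u. -/
theorem positive_term_le {q s : ℝ} (h0 : 0 < q) (h1 : q < 1) (hs : 0 < s) (hs' : s ≤ 1 / 2)
    (m : ℕ) :
    (1 - q) * (1 / (1 - q ^ (m + 1))) ^ s ≤
      (1 - q) + (s * Real.log 2 ^ 2 + 32 * s ^ 2) / (m + 1) := by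
  set u := q ^ (m + 1) with hu
  have hu0 : 0 < u := by positivity
  have hu1 : u < 1 := pow_lt_one₀ h0.le h1 (by omega)
  set w := -Real.log (1 - u) with hw
  have hw0 : 0 ≤ w := by
    have := Real.log_nonpos (x := 1 - u) (by linarith) (by linarith)
    linarith
  have hz : (1 / (1 - u)) ^ s = Real.exp (s * w) := by
    rw [Real.rpow_def_of_pos (by rw [one_div, inv_pos]; linarith), one_div, Real.log_inv, mul_comm]
  rw [hz]
  have hp : (1 - q) * (m + 1) ≤ -Real.log u := by
    have := Real.log_le_sub_one_of_pos h0
    rw [hu, Real.log_pow]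
    push_cast
    nlinarith [(Nat.cast_nonneg m : (0 : ℝ) ≤ m)]
  have e1 := Real.exp_sub_one_le_add_sq_mul_exp (mul_nonneg hs.le hw0)
  have e2 : Real.exp (s * w) ≤ Real.exp (w / 2) := Real.exp_le_exp.2 (by nlinarith)
  have e3 : Real.exp (s * w) - 1 ≤ s * w + s ^ 2 * (w ^ 2 * Real.exp (w / 2)) := by
    have : (s * w) ^ 2 * Real.exp (s * w) ≤ (s * w) ^ 2 * Real.exp (w / 2) := by gcongr
    calc _ ≤ _ := e1
      _ ≤ s * w + (s * w) ^ 2 * Real.exp (w / 2) := by gcongr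
      _ = _ := by ring
  have k1 := log_mul_log_one_sub_le hu0 hu1
  have k2 := neg_log_mul_log_one_sub_sq_mul_exp_le hu0 hu1
  have k1' : -Real.log u * w ≤ Real.log 2 ^ 2 := by rw [hw]; linarith
  have k2' : -Real.log u * (w ^ 2 * Real.exp (w / 2)) ≤ 32 := by
    calc _ = _ := by rw [hw]; ring
      _ ≤ _ := k2
  have hpos : 0 ≤ Real.exp (s * w) - 1 := by
    have := Real.one_le_exp (mul_nonneg hs.le hw0); linarith
  have hmain : (1 - q) * (Real.exp (s * w) - 1) * (m + 1) ≤ s * Real.log 2 ^ 2 + 32 * s ^ 2 := by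
    have ha : 0 ≤ -Real.log u := by
      have := Real.log_nonpos hu0.le hu1.le
      linarith
    calc (1 - q) * (Real.exp (s * w) - 1) * (m + 1)
        = ((1 - q) * (m + 1)) * (Real.exp (s * w) - 1) := by ring
      _ ≤ (-Real.log u) * (s * w + s ^ 2 * (w ^ 2 * Real.exp (w / 2))) := by gcongr
      _ = s * (-Real.log u * w) + s ^ 2 * (-Real.log u * (w ^ 2 * Real.exp (w / 2))) := by ring
      _ ≤ s * Real.log 2 ^ 2 + s ^ 2 * 32 := by gcongr
      _ = _ := by ring
  have : (1 - q) * (Real.exp (s * w) - 1) ≤ (s * Real.log 2 ^ 2 + 32 * s ^ 2) / (m + 1) := by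
    rw [le_div_iff₀ (by positivity)]
    exact hmain
  linarith

/-- Split q^m into two halves q^k and apply (1 - q) q^k ≤ 1 / (k + 1) to each. -/
theorem sq_mul_pow_le {q : ℝ} (h0 : 0 ≤ q) (h1 : q ≤ 1) (m : ℕ) :
    (1 - q) ^ 2 * q ^ m ≤ 4 / (m + 1) ^ 2 := by
  obtain ⟨k, hk, hk'⟩ : ∃ k : ℕ, 2 * k ≤ m ∧ m ≤ 2 * k + 1 := ⟨m / 2, by omega, by omega⟩
  have h := succ_mul_one_sub_mul_pow_le h0 h1 k
  have hpos : 0 ≤ (k + 1 : ℝ) * ((1 - q) * q ^ k) :=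
    mul_nonneg (by positivity) (mul_nonneg (by linarith) (by positivity))
  have hle : (k + 1 : ℝ) * ((1 - q) * q ^ k) ≤ 1 := by
    have : 0 ≤ q ^ (k + 1) := by positivity
    linarith
  have hm : (m + 1 : ℝ) ≤ 2 * (k + 1) := by
    have : (m : ℝ) ≤ 2 * k + 1 := by exact_mod_cast hk'
    linarith
  rw [le_div_iff₀ (by positivity)]
  calc (1 - q) ^ 2 * q ^ m * (m + 1) ^ 2
      ≤ (1 - q) ^ 2 * q ^ (2 * k) * (2 * (k + 1)) ^ 2 := by
        gcongr ?_ * ?_ * ?_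
        · exact pow_le_pow_of_le_one h0 h1 hk
        · gcongr
    _ = 4 * ((k + 1 : ℝ) * ((1 - q) * q ^ k)) ^ 2 := by ring
    _ ≤ 4 * 1 ^ 2 := by gcongr
    _ = 4 := by norm_num

theorem rpow_le_one_add_mul_sub_one {z s : ℝ} (hz : 0 ≤ z) (hs : 0 ≤ s) (hs' : s ≤ 1) :
    z ^ s ≤ 1 + s * (z - 1) := by
  have := rpow_one_add_le_one_add_mul_self (s := z - 1) (by linarith) hs hs'
  rwa [add_sub_cancel] at this

/-- The item is not in the test. After Bernoulli's inequality the negative and the positive outcome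
contribute first-order terms of opposite sign, which cancel up to order s / (m + 1)². -/
theorem negative_terms_le {q s : ℝ} (h0 : 0 < q) (h1 : q < 1) (hs : 0 ≤ s) (hs' : s ≤ 1)
    (m : ℕ) :
    q ^ (m + 1) * (1 / q) ^ s + (q - q ^ (m + 1)) * ((1 - q ^ m) / (1 - q ^ (m + 1))) ^ s ≤
      q + 5 * s / (m + 1) ^ 2 := by
  have hm : 0 ≤ 1 - q ^ m := by linarith [pow_le_one₀ (n := m) h0.le h1.le]
  have hm' : 0 < 1 - q ^ (m + 1) := by linarith [pow_lt_one₀ (n := m + 1) h0.le h1 (by omega)]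
  have hpm := succ_mul_one_sub_mul_pow_le h0.le h1.le m
  have hsq := sq_mul_pow_le h0.le h1.le m
  have e1 := rpow_le_one_add_mul_sub_one (z := 1 / q) (by positivity) hs hs'
  have e2 := rpow_le_one_add_mul_sub_one (div_nonneg hm hm'.le) hs hs'
  set t := (1 - q) * q ^ m / (1 - q ^ (m + 1)) with ht
  have hz : (1 - q ^ m) / (1 - q ^ (m + 1)) = 1 - t := by
    rw [ht]
    field_simp
    ring
  rw [hz] at e2 ⊢
  have ht1 : t ≤ 1 / (m + 1) := by
    rw [ht, div_le_div_iff₀ hm' (by positivity)]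
    linarith
  have hcoef : (q - q ^ (m + 1)) * t = q * ((1 - q) * q ^ m) * (1 - t) := by
    rw [← hz, ht, pow_succ]
    field_simp
  have hpq : (1 - q) * q ^ m ≤ 1 / (m + 1) := by
    rw [le_div_iff₀ (by positivity)]
    have : 0 ≤ q ^ (m + 1) := by positivity
    linarith
  have hpq0 : 0 ≤ (1 - q) * q ^ m := mul_nonneg (by linarith) (by positivity)
  have hw : 0 ≤ q - q ^ (m + 1) := by rw [pow_succ]; nlinarith
  have hfirst : q ^ (m + 1) * (1 + s * (1 / q - 1)) = q ^ (m + 1) + s * ((1 - q) * q ^ m) := by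
    rw [pow_succ]
    field_simp
  calc _ ≤ q ^ (m + 1) * (1 + s * (1 / q - 1)) + (q - q ^ (m + 1)) * (1 + s * (1 - t - 1)) := by
        gcongr
    _ = q + s * ((1 - q) * q ^ m - (q - q ^ (m + 1)) * t) := by
        rw [hfirst]
        ring
    -- The cancellation: what remains is a sum of two products of two factors of order 1 / (m + 1).
    _ = q + s * ((1 - q) ^ 2 * q ^ m + ((1 - q) * q ^ m) * (q * t)) := by
        rw [hcoef]
        ring
    _ ≤ q + s * (4 / (m + 1) ^ 2 + 1 / (m + 1) * (1 * (1 / (m + 1)))) := by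
        have ht0 : 0 ≤ t := div_nonneg hpq0 hm'.le
        gcongr
    _ = _ := by
        field_simp
        ring

theorem likelihoodMoment_eq {q s : ℝ} (h0 : 0 < q) (h1 : q < 1) {m : ℕ} :
    likelihoodMoment (1 - q) m s =
      (1 - q) * (1 / (1 - q ^ (m + 1))) ^ s +
      (q ^ (m + 1) * (1 / q) ^ s +
        (q - q ^ (m + 1)) * ((1 - q ^ m) / (1 - q ^ (m + 1))) ^ s) := by
  have hp : 1 - q ≠ 0 := by linarith
  have hm' : 1 - q ^ (m + 1) ≠ 0 := by
    linarith [pow_lt_one₀ (n := m + 1) h0.le h1 (by omega)]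
  simp only [likelihoodMoment, jointProb, itemProb, condOutcomeProb, outcomeProb, Fintype.sum_bool,
    if_true, Bool.false_eq_true, if_false, sub_sub_cancel, mul_zero, zero_mul, add_zero]
  have r1 : (1 - q) * 1 / ((1 - q) * (1 - q ^ (m + 1))) = 1 / (1 - q ^ (m + 1)) := by
    field_simp
  have r2 : q * (1 - q ^ m) / (q * (1 - q ^ (m + 1))) = (1 - q ^ m) / (1 - q ^ (m + 1)) := by
    field_simp
  have r3 : q * q ^ m / (q * q ^ (m + 1)) = 1 / q := by
    rw [pow_succ]
    field_simp
  rw [r1, r2, r3, pow_succ]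
  ring

theorem likelihoodMoment_le {p s : ℝ} (h0 : 0 ≤ p) (h1 : p ≤ 1) (hs : 0 < s) (hs' : s ≤ 1 / 2)
    {m : ℕ} (hm : m ≠ 0) :
    likelihoodMoment p m s ≤
      1 + (s * Real.log 2 ^ 2 + 32 * s ^ 2) / (m + 1) + 5 * s / (m + 1) ^ 2 := by
  have hA : 0 ≤ (s * Real.log 2 ^ 2 + 32 * s ^ 2) / (m + 1) := by positivity
  have hB : 0 ≤ 5 * s / (m + 1 : ℝ) ^ 2 := by positivity
  rcases eq_or_lt_of_le h0 with rfl | h0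
  · have : likelihoodMoment 0 m s = 1 := by
      simp [likelihoodMoment, jointProb, itemProb, condOutcomeProb, outcomeProb]
    linarith
  rcases eq_or_lt_of_le h1 with rfl | h1
  · have : likelihoodMoment 1 m s = 1 := by
      simp [likelihoodMoment, jointProb, itemProb, condOutcomeProb, outcomeProb]
    linarith
  have h := likelihoodMoment_eq (q := 1 - p) (s := s) (m := m) (by linarith) (by linarith)
  have hp := positive_term_le (q := 1 - p) (by linarith) (by linarith) hs hs' m
  have hn := negative_terms_le (q := 1 - p) (by linarith) (by linarith) hs.le (by linarith) m
  rw [sub_sub_cancel] at h hp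
  linarith

/-! ### Laws of rows and outcomes over all tests -/

open Finset

variable {n ℓ : ℕ}

theorem sum_itemProb (p : ℝ) : ∑ x, itemProb p x = 1 := by simp [itemProb]

theorem sum_outcomeProb (p : ℝ) (m : ℕ) : ∑ y, outcomeProb p m y = 1 := by simp [outcomeProb]

theorem itemProb_nonneg {p : ℝ} (h0 : 0 ≤ p) (h1 : p ≤ 1) (x : Bool) : 0 ≤ itemProb p x := by
  cases x <;> simp [itemProb] <;> linarith

theorem outcomeProb_nonneg {p : ℝ} (h0 : 0 ≤ p) (h1 : p ≤ 1) (m : ℕ) (y : Bool) :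
    0 ≤ outcomeProb p m y := by
  have h2 := pow_le_one₀ (n := m) (sub_nonneg.2 h1) (by linarith)
  have h3 := pow_nonneg (sub_nonneg.2 h1) m
  cases y <;> simp [outcomeProb] <;> linarith

theorem jointProb_nonneg {p : ℝ} (h0 : 0 ≤ p) (h1 : p ≤ 1) (m : ℕ) (x y : Bool) :
    0 ≤ jointProb p m x y := by
  refine mul_nonneg (itemProb_nonneg h0 h1 x) ?_
  have := outcomeProb_nonneg h0 h1 m y
  cases x <;> cases y <;> simp [condOutcomeProb, this]

theorem sum_jointProb (p : ℝ) (m : ℕ) (y : Bool) :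
    ∑ x, jointProb p m x y = outcomeProb p (m + 1) y := by
  cases y <;> simp [jointProb, itemProb, condOutcomeProb, outcomeProb] <;> ring

theorem jointProb_eq_zero {p : ℝ} (h0 : 0 ≤ p) (h1 : p ≤ 1) {m : ℕ} {x y : Bool}
    (h : itemProb p x * outcomeProb p (m + 1) y = 0) : jointProb p m x y = 0 := by
  rcases mul_eq_zero.1 h with h | h
  · simp [jointProb, h]
  · rw [← sum_jointProb, sum_eq_zero_iff_of_nonneg fun x _ => jointProb_nonneg h0 h1 m x y] at h
    exact h x (mem_univ x)

/-- The outcome is the disjunction of x with the outcome z on the other m defectives. -/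
theorem condOutcomeProb_eq_sum (p : ℝ) (m : ℕ) (x y : Bool) :
    condOutcomeProb p m x y = ∑ z, outcomeProb p m z * if (x || z) = y then 1 else 0 := by
  cases x <;> cases y <;> simp [condOutcomeProb, outcomeProb]

/-- The law of the row of an item. -/
noncomputable def rowProb (p : Fin ℓ → unitInterval) (x : Fin ℓ → Bool) : ℝ :=
  ∏ i, itemProb (p i) (x i)

/-- The law of the outcomes of the tests on `m` defectives. -/
noncomputable def outcomesProb (p : Fin ℓ → unitInterval) (m : ℕ) (y : Fin ℓ → Bool) : ℝ :=
  ∏ i, outcomeProb (p i) m (y i)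

/-- The joint law of the row of a defective and the outcomes, with `m` further defectives. -/
noncomputable def rowOutcomesProb (p : Fin ℓ → unitInterval) (m : ℕ) (x y : Fin ℓ → Bool) : ℝ :=
  ∏ i, jointProb (p i) m (x i) (y i)

theorem rowProb_nonneg (p : Fin ℓ → unitInterval) (x : Fin ℓ → Bool) : 0 ≤ rowProb p x :=
  prod_nonneg fun i _ => itemProb_nonneg (p i).2.1 (p i).2.2 _

theorem outcomesProb_nonneg (p : Fin ℓ → unitInterval) (m : ℕ) (y : Fin ℓ → Bool) :
    0 ≤ outcomesProb p m y :=
  prod_nonneg fun i _ => outcomeProb_nonneg (p i).2.1 (p i).2.2 _ _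

theorem rowOutcomesProb_nonneg (p : Fin ℓ → unitInterval) (m : ℕ) (x y : Fin ℓ → Bool) :
    0 ≤ rowOutcomesProb p m x y :=
  prod_nonneg fun i _ => jointProb_nonneg (p i).2.1 (p i).2.2 _ _ _

theorem sum_prod_apply (f : Fin ℓ → Bool → ℝ) : ∑ x : Fin ℓ → Bool, ∏ i, f i (x i) =
    ∏ i, ∑ b, f i b := by
  rw [prod_univ_sum, Fintype.piFinset_univ]

theorem sum_rowProb (p : Fin ℓ → unitInterval) : ∑ x, rowProb p x = 1 := by
  simp only [rowProb]
  rw [sum_prod_apply fun i b => itemProb (p i) b]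
  exact prod_eq_one fun i _ => sum_itemProb _

theorem sum_outcomesProb (p : Fin ℓ → unitInterval) (m : ℕ) : ∑ y, outcomesProb p m y = 1 := by
  simp only [outcomesProb]
  rw [sum_prod_apply fun i b => outcomeProb (p i) m b]
  exact prod_eq_one fun i _ => sum_outcomeProb _ _

theorem sum_rowOutcomesProb (p : Fin ℓ → unitInterval) (m : ℕ) (y : Fin ℓ → Bool) :
    ∑ x, rowOutcomesProb p m x y = outcomesProb p (m + 1) y := by
  simp only [rowOutcomesProb]
  rw [sum_prod_apply fun i b => jointProb (p i) m b (y i)]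
  exact prod_congr rfl fun i _ => sum_jointProb _ _ _

theorem prod_condOutcomeProb (p : Fin ℓ → unitInterval) (m : ℕ) (x y : Fin ℓ → Bool) :
    ∏ i, condOutcomeProb (p i) m (x i) (y i) =
      ∑ z, outcomesProb p m z * if (fun i => x i || z i) = y then 1 else 0 := by
  simp only [condOutcomeProb_eq_sum]
  rw [← sum_prod_apply fun i b => outcomeProb (p i) m b * if (x i || b) = y i then 1 else 0]
  refine sum_congr rfl fun z _ => ?_
  rw [prod_mul_distrib, prod_boole]
  simp [outcomesProb, funext_iff]

theorem rowProb_mul_sum (p : Fin ℓ → unitInterval) (m : ℕ) (x : Fin ℓ → Bool)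
    (φ : (Fin ℓ → Bool) → ℝ) :
    rowProb p x * ∑ z, outcomesProb p m z * φ (fun i => x i || z i) =
      ∑ y, rowOutcomesProb p m x y * φ y := by
  have h : ∀ y, rowOutcomesProb p m x y =
      rowProb p x * ∑ z, outcomesProb p m z * if (fun i => x i || z i) = y then 1 else 0 := by
    intro y
    rw [← prod_condOutcomeProb, rowProb, ← prod_mul_distrib]
    rfl
  simp only [h, mul_assoc, ← mul_sum, sum_mul]
  rw [sum_comm]
  congr 1
  refine sum_congr rfl fun z _ => ?_
  rw [← mul_sum]
  simp

theorem designProb_eq (p : Fin ℓ → unitInterval) (X : Fin n → Fin ℓ → Bool) :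
    designProb p X = ∏ j, rowProb p (X j) := rfl

theorem designProb_nonneg (p : Fin ℓ → unitInterval) (X : Fin n → Fin ℓ → Bool) :
    0 ≤ designProb p X :=
  prod_nonneg fun j _ => rowProb_nonneg p (X j)

theorem designProb_update_mul (p : Fin ℓ → unitInterval) (X : Fin n → Fin ℓ → Bool) (j : Fin n)
    (x : Fin ℓ → Bool) :
    designProb p (Function.update X j x) * rowProb p (X j) = designProb p X * rowProb p x := by
  rw [designProb_eq, designProb_eq, ← mul_prod_erase univ _ (mem_univ j),
    ← mul_prod_erase univ (fun k => rowProb p (X k)) (mem_univ j), Function.update_self]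
  have : ∏ k ∈ univ.erase j, rowProb p (Function.update X j x k) =
      ∏ k ∈ univ.erase j, rowProb p (X k) :=
    prod_congr rfl fun k hk => by rw [Function.update_of_ne (ne_of_mem_erase hk)]
  rw [this]
  ring

/-- Drawing the row of one item anew does not change the law of the design. -/
theorem sum_designProb_resample (p : Fin ℓ → unitInterval) (j : Fin n)
    (F : (Fin n → Fin ℓ → Bool) → ℝ) :
    ∑ X, designProb p X * F X =
      ∑ X, designProb p X * ∑ x, rowProb p x * F (Function.update X j x) := by
  calc ∑ X, designProb p X * F X
      = ∑ X : Fin n → Fin ℓ → Bool, ∑ x, designProb p X * rowProb p x * F X := by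
        refine sum_congr rfl fun X _ => ?_
        rw [← sum_mul, ← mul_sum, sum_rowProb, mul_one]
    _ = ∑ a : (Fin n → Fin ℓ → Bool) × (Fin ℓ → Bool),
          designProb p a.1 * rowProb p a.2 * F a.1 := by
        rw [Fintype.sum_prod_type]
    _ = ∑ a : (Fin n → Fin ℓ → Bool) × (Fin ℓ → Bool),
          designProb p a.1 * rowProb p a.2 * F (Function.update a.1 j a.2) := by
        -- Exchanging row j with the fresh row preserves the joint law of design and fresh row.
        have hinv : Function.Involutive fun a : (Fin n → Fin ℓ → Bool) × (Fin ℓ → Bool) =>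
            (Function.update a.1 j a.2, a.1 j) := fun a => by simp
        refine Fintype.sum_equiv hinv.toPerm _ _ fun a => ?_
        simp [designProb_update_mul]
    _ = _ := by
        rw [Fintype.sum_prod_type]
        simp only [mul_sum, mul_assoc]

theorem sum_designProb (p : Fin ℓ → unitInterval) :
    ∑ X : Fin n → Fin ℓ → Bool, designProb p X = 1 := by
  simp only [designProb_eq]
  have := prod_univ_sum (fun _ : Fin n => (univ : Finset (Fin ℓ → Bool))) fun _ => rowProb p
  rw [Fintype.piFinset_univ] at this
  rw [← this]
  exact prod_eq_one fun j _ => sum_rowProb p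

theorem testOutcome_insert (D : Finset (Fin n)) (j : Fin n) (X : Fin n → Fin ℓ → Bool) :
    testOutcome (insert j D) X = fun i => X j i || testOutcome D X i := by
  funext i
  simp [testOutcome]

theorem testOutcome_update (D : Finset (Fin n)) {j : Fin n} (hj : j ∉ D)
    (X : Fin n → Fin ℓ → Bool) (x : Fin ℓ → Bool) :
    testOutcome D (Function.update X j x) = testOutcome D X := by
  funext i
  refine decide_eq_decide.2 (exists_congr fun k => and_congr_right fun hk => ?_)
  rw [Function.update_of_ne (ne_of_mem_of_not_mem hk hj)]

/-- The outcome law for D is a hypothesis so that this serves both as the induction step of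
`sum_designProb_outcome` and, afterwards, for `sum_designProb_row_outcome`. -/
theorem sum_designProb_row_outcome_of_law (p : Fin ℓ → unitInterval) {D : Finset (Fin n)}
    {j : Fin n} (hj : j ∉ D)
    (hD : ∀ φ : (Fin ℓ → Bool) → ℝ, ∑ X, designProb p X * φ (testOutcome D X) =
      ∑ y, outcomesProb p #D y * φ y)
    (φ : (Fin ℓ → Bool) → (Fin ℓ → Bool) → ℝ) :
    ∑ X, designProb p X * φ (X j) (testOutcome (insert j D) X) =
      ∑ x, ∑ y, rowOutcomesProb p #D x y * φ x y := by
  rw [sum_designProb_resample p j]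
  simp only [testOutcome_insert, testOutcome_update D hj, Function.update_self, mul_sum]
  rw [sum_comm]
  refine sum_congr rfl fun x _ => ?_
  rw [← rowProb_mul_sum p #D x (φ x), ← hD fun z => φ x fun i => x i || z i, mul_sum]
  exact sum_congr rfl fun X _ => by ring

theorem sum_designProb_outcome (p : Fin ℓ → unitInterval) (D : Finset (Fin n))
    (φ : (Fin ℓ → Bool) → ℝ) :
    ∑ X, designProb p X * φ (testOutcome D X) = ∑ y, outcomesProb p #D y * φ y := by
  induction D using Finset.induction_on generalizing φ with
  | empty =>
    have h : ∀ y : Fin ℓ → Bool, outcomesProb p 0 y = if (fun _ => false) = y then 1 else 0 := by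
      intro y
      have : ∀ i, outcomeProb (p i) 0 (y i) = if false = y i then 1 else 0 := by
        intro i
        cases y i <;> simp [outcomeProb]
      simp only [outcomesProb, this, prod_boole, funext_iff, mem_univ, true_implies]
    have h' : ∀ X : Fin n → Fin ℓ → Bool, testOutcome ∅ X = fun _ => false := by
      intro X
      funext i
      simp [testOutcome]
    simp only [h', card_empty, h, ← sum_mul, sum_designProb]
    simp
  | insert j D hj ih =>
    rw [sum_designProb_row_outcome_of_law p hj ih fun _ => φ, sum_comm, card_insert_of_notMem hj]
    simp only [← sum_mul, sum_rowOutcomesProb]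

theorem sum_designProb_row_outcome (p : Fin ℓ → unitInterval) {D : Finset (Fin n)} {j : Fin n}
    (hj : j ∈ D) {m : ℕ} (hD : #D = m + 1) (φ : (Fin ℓ → Bool) → (Fin ℓ → Bool) → ℝ) :
    ∑ X, designProb p X * φ (X j) (testOutcome D X) =
      ∑ x, ∑ y, rowOutcomesProb p m x y * φ x y := by
  have h := sum_designProb_row_outcome_of_law p (notMem_erase j D)
    (sum_designProb_outcome p (D.erase j)) φ
  rwa [insert_erase hj, card_erase_of_mem hj, hD, Nat.add_sub_cancel] at h

/-- Given the outcomes, the rows of non-defective items are independent. -/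
theorem sum_designProb_outcome_mul_prod (p : Fin ℓ → unitInterval) (D S : Finset (Fin n))
    (hS : Disjoint S D) (φ : (Fin ℓ → Bool) → ℝ)
    (f : Fin n → (Fin ℓ → Bool) → (Fin ℓ → Bool) → ℝ) :
    ∑ X, designProb p X * (φ (testOutcome D X) * ∏ j ∈ S, f j (X j) (testOutcome D X)) =
      ∑ X, designProb p X * (φ (testOutcome D X) *
        ∏ j ∈ S, ∑ x, rowProb p x * f j x (testOutcome D X)) := by
  induction S using Finset.induction_on generalizing φ with
  | empty => simp
  | insert j S hj ih =>
    rw [disjoint_insert_left] at hS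
    -- Once averaged, the factor of j depends on the outcomes alone and can join the weight φ.
    have h := ih hS.2 fun y => φ y * ∑ x, rowProb p x * f j x y
    simp only [prod_insert hj, ← mul_assoc] at h ⊢
    rw [← h]
    simp only [mul_assoc]
    rw [sum_designProb_resample p j]
    refine sum_congr rfl fun X _ => ?_
    have : ∀ x, ∏ k ∈ S, f k (Function.update X j x k) (testOutcome D X) =
        ∏ k ∈ S, f k (X k) (testOutcome D X) := fun x =>
      prod_congr rfl fun k hk => by rw [Function.update_of_ne (ne_of_mem_of_not_mem hk hj)]
    simp only [testOutcome_update D hS.1, Function.update_self, this]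
    simp only [mul_sum, sum_mul]
    exact sum_congr rfl fun x _ => by ring

/-! ### Change of measure -/

/-- Either the ratio A / B is at most exp τ, or its s-th power exceeds exp (s τ), as in Markov's
inequality. Absolute continuity `hAB` excludes B = 0 < A, where the ratio would be read as 0. -/
theorem mul_le_threshold {A B τ s : ℝ} (hA : 0 ≤ A) (hB : 0 ≤ B) (hAB : B = 0 → A = 0)
    (hs : 0 ≤ s) :
    A ≤ Real.exp τ * B + Real.exp (-(s * τ)) * (A * (A / B) ^ s) := by
  rcases le_or_gt A (Real.exp τ * B) with h | h
  · have : 0 ≤ Real.exp (-(s * τ)) * (A * (A / B) ^ s) := by positivity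
    linarith
  · have hB' : 0 < B := lt_of_le_of_ne hB fun h0 => by
      rw [hAB h0.symm, ← h0] at h
      simp at h
    have h1 : Real.exp τ ≤ A / B := by rw [le_div_iff₀ hB']; exact h.le
    have h2 : Real.exp (s * τ) ≤ (A / B) ^ s := by
      rw [mul_comm, Real.exp_mul]
      exact Real.rpow_le_rpow (Real.exp_pos _).le h1 hs
    have h3 : 1 ≤ Real.exp (-(s * τ)) * (A / B) ^ s := by
      calc (1 : ℝ) = Real.exp (-(s * τ)) * Real.exp (s * τ) := by rw [← Real.exp_add]; simp
        _ ≤ _ := by gcongr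
    have h4 : 0 ≤ Real.exp τ * B := by positivity
    nlinarith

/-- Change of measure from the law of a defective item to that of a non-defective one. -/
theorem sum_rowOutcomesProb_le (p : Fin ℓ → unitInterval) (m : ℕ)
    (φ : (Fin ℓ → Bool) → (Fin ℓ → Bool) → ℝ) (h0 : ∀ x y, 0 ≤ φ x y) (h1 : ∀ x y, φ x y ≤ 1)
    {s : ℝ} (hs : 0 ≤ s) (τ : ℝ) :
    ∑ x, ∑ y, rowOutcomesProb p m x y * φ x y ≤
      Real.exp τ * ∑ x, ∑ y, rowProb p x * outcomesProb p (m + 1) y * φ x y +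
        Real.exp (-(s * τ)) * ∏ i, likelihoodMoment (p i) m s := by
  set R : (Fin ℓ → Bool) → (Fin ℓ → Bool) → ℝ := fun x y => rowOutcomesProb p m x y *
    (rowOutcomesProb p m x y / (rowProb p x * outcomesProb p (m + 1) y)) ^ s with hR
  have hR0 : ∀ x y, 0 ≤ R x y := fun x y => by
    have := rowOutcomesProb_nonneg p m x y
    have := rowProb_nonneg p x
    have := outcomesProb_nonneg p (m + 1) y
    positivity
  have hRsum : ∑ x, ∑ y, R x y = ∏ i, likelihoodMoment (p i) m s := by
    have hprod : ∀ x y, R x y = ∏ i, (jointProb (p i) m (x i) (y i) *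
        (jointProb (p i) m (x i) (y i) /
          (itemProb (p i) (x i) * outcomeProb (p i) (m + 1) (y i))) ^ s) := by
      intro x y
      simp only [hR, rowOutcomesProb, rowProb, outcomesProb]
      rw [← prod_mul_distrib, ← prod_div_distrib, ← Real.finsetProd_rpow, ← prod_mul_distrib]
      exact fun i _ => div_nonneg (jointProb_nonneg (p i).2.1 (p i).2.2 _ _ _)
        (mul_nonneg (itemProb_nonneg (p i).2.1 (p i).2.2 _)
          (outcomeProb_nonneg (p i).2.1 (p i).2.2 _ _))
    simp only [hprod]
    calc _ = ∑ x : Fin ℓ → Bool, ∏ i, ∑ b, (jointProb (p i) m (x i) b *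
        (jointProb (p i) m (x i) b /
          (itemProb (p i) (x i) * outcomeProb (p i) (m + 1) b)) ^ s) := by
          refine sum_congr rfl fun x _ => ?_
          rw [sum_prod_apply fun i b => jointProb (p i) m (x i) b *
            (jointProb (p i) m (x i) b /
              (itemProb (p i) (x i) * outcomeProb (p i) (m + 1) b)) ^ s]
      _ = _ := by
          rw [sum_prod_apply fun i a => ∑ b, (jointProb (p i) m a b *
            (jointProb (p i) m a b / (itemProb (p i) a * outcomeProb (p i) (m + 1) b)) ^ s)]
          rfl
  rw [← hRsum]
  simp only [mul_sum, ← sum_add_distrib]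
  refine sum_le_sum fun x _ => sum_le_sum fun y _ => ?_
  have hz : rowProb p x * outcomesProb p (m + 1) y = 0 → rowOutcomesProb p m x y = 0 := by
    rw [rowProb, outcomesProb, ← prod_mul_distrib]
    intro h
    obtain ⟨i, hi, h⟩ := prod_eq_zero_iff.1 h
    exact prod_eq_zero hi (jointProb_eq_zero (p i).2.1 (p i).2.2 h)
  have key := mul_le_threshold (τ := τ) (rowOutcomesProb_nonneg p m x y)
    (mul_nonneg (rowProb_nonneg p x) (outcomesProb_nonneg p (m + 1) y)) hz hs
  have key' := mul_le_mul_of_nonneg_right key (h0 x y)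
  have h2 : Real.exp (-(s * τ)) * R x y * φ x y ≤ Real.exp (-(s * τ)) * R x y :=
    mul_le_of_le_one_right (mul_nonneg (Real.exp_pos _).le (hR0 x y)) (h1 x y)
  calc _ ≤ _ := key'
    _ = Real.exp τ * (rowProb p x * outcomesProb p (m + 1) y * φ x y) +
        Real.exp (-(s * τ)) * R x y * φ x y := by rw [hR]; ring
    _ ≤ _ := by gcongr

/-! ### False alarms and true positives for fixed biases -/

/-- The probability that a non-defective item is declared defective, given the outcomes `y`. -/
noncomputable def falseAlarm (p : Fin ℓ → unitInterval)
    (acc : Fin n → (Fin ℓ → Bool) → (Fin ℓ → Bool) → Bool) (y : Fin ℓ → Bool) (j : Fin n) : ℝ :=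
  ∑ x, rowProb p x * if acc j x y = true then 1 else 0

section

variable (p : Fin ℓ → unitInterval) (acc : Fin n → (Fin ℓ → Bool) → (Fin ℓ → Bool) → Bool)

theorem falseAlarm_le_one (y : Fin ℓ → Bool) (j : Fin n) : falseAlarm p acc y j ≤ 1 := by
  rw [← sum_rowProb p]
  exact sum_le_sum fun x _ => mul_le_of_le_one_right (rowProb_nonneg p x)
    (by split_ifs <;> norm_num)

/-- By conditional independence, no false alarm occurs with probability ∏ (1 - f_j) ≤ exp (-∑ f_j),
given the outcomes. -/
theorem no_false_positive_le (D : Finset (Fin n)) (C : ℝ) :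
    ∑ X, designProb p X * (if (∀ j ∈ Dᶜ, ¬ acc j (X j) (testOutcome D X) = true) ∧
      C < ∑ j ∈ Dᶜ, falseAlarm p acc (testOutcome D X) j then 1 else 0) ≤ Real.exp (-C) := by
  have h := sum_designProb_outcome_mul_prod p D Dᶜ disjoint_compl_left
    (fun y => if C < ∑ j ∈ Dᶜ, falseAlarm p acc y j then 1 else 0)
    (fun j x y => if ¬ acc j x y = true then 1 else 0)
  have hcompl : ∀ y j, ∑ x, rowProb p x * (if ¬ acc j x y = true then 1 else 0) =
      1 - falseAlarm p acc y j := by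
    intro y j
    rw [falseAlarm, ← congrArg (· - _) (sum_rowProb p), ← sum_sub_distrib]
    refine sum_congr rfl fun x _ => ?_
    by_cases hx : acc j x y = true <;> simp [hx]
  have hind : ∀ X : Fin n → Fin ℓ → Bool,
      (if (∀ j ∈ Dᶜ, ¬ acc j (X j) (testOutcome D X) = true) ∧
        C < ∑ j ∈ Dᶜ, falseAlarm p acc (testOutcome D X) j then (1 : ℝ) else 0) =
      (if C < ∑ j ∈ Dᶜ, falseAlarm p acc (testOutcome D X) j then 1 else 0) *
        ∏ j ∈ Dᶜ, if ¬ acc j (X j) (testOutcome D X) = true then 1 else 0 := by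
    intro X
    rw [prod_boole, ite_zero_mul_ite_zero, one_mul]
    split_ifs <;> tauto
  simp only [hind, h, hcompl]
  refine (sum_le_sum (g := fun X => designProb p X * Real.exp (-C)) fun X _ =>
    mul_le_mul_of_nonneg_left ?_ (designProb_nonneg p X)).trans_eq
      (by rw [← sum_mul, sum_designProb, one_mul])
  split_ifs with hC
  · rw [one_mul]
    calc ∏ j ∈ Dᶜ, (1 - falseAlarm p acc (testOutcome D X) j)
        ≤ ∏ j ∈ Dᶜ, Real.exp (-falseAlarm p acc (testOutcome D X) j) :=
          prod_le_prod (fun j _ => sub_nonneg.2 (falseAlarm_le_one p acc _ j))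
            fun j _ => Real.one_sub_le_exp_neg _
      _ = Real.exp (-∑ j ∈ Dᶜ, falseAlarm p acc (testOutcome D X) j) := by
          rw [← Real.exp_sum, sum_neg_distrib]
      _ ≤ Real.exp (-C) := Real.exp_le_exp.2 (by linarith)
  · rw [zero_mul]
    exact (Real.exp_pos _).le

/-- The cap runs over the complement of `D.erase j`, so j itself is counted: after the change of
measure the bound depends only on `D.erase j` and j, with j on the same footing as the non-defective
items. -/
theorem true_positive_le {D : Finset (Fin n)} {j : Fin n} (hj : j ∈ D) {m : ℕ} (hD : #D = m + 1)
    (C : ℝ) {s : ℝ} (hs : 0 ≤ s) (τ : ℝ) :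
    ∑ X, designProb p X * (if acc j (X j) (testOutcome D X) = true ∧
      ∑ k ∈ (D.erase j)ᶜ, falseAlarm p acc (testOutcome D X) k ≤ C then 1 else 0) ≤
    Real.exp τ * ∑ y, outcomesProb p (m + 1) y *
      (if ∑ k ∈ (D.erase j)ᶜ, falseAlarm p acc y k ≤ C then falseAlarm p acc y j else 0) +
    Real.exp (-(s * τ)) * ∏ i, likelihoodMoment (p i) m s := by
  rw [sum_designProb_row_outcome p hj hD fun x y => if acc j x y = true ∧
    ∑ k ∈ (D.erase j)ᶜ, falseAlarm p acc y k ≤ C then 1 else 0]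
  refine (sum_rowOutcomesProb_le p m _ (fun x y => by split_ifs <;> norm_num)
    (fun x y => by split_ifs <;> norm_num) hs τ).trans_eq ?_
  congr 2
  rw [sum_comm]
  refine sum_congr rfl fun y _ => ?_
  split_ifs with h
  · rw [falseAlarm, mul_sum]
    refine sum_congr rfl fun x _ => ?_
    simp only [and_iff_left h]
    ring
  · rw [mul_zero]
    exact sum_eq_zero fun x _ => by rw [if_neg fun h' => h h'.2, mul_zero]

end

/-! ### Averaging over the defective set -/

theorem sum_powersetCard_erase (m : ℕ) (h : Finset (Fin n) → Fin n → ℝ) :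
    ∑ D ∈ powersetCard (m + 1) univ, ∑ j ∈ D, h (D.erase j) j =
      ∑ D ∈ powersetCard m univ, ∑ j ∈ Dᶜ, h D j := by
  rw [sum_sigma', sum_sigma']
  refine sum_bij' (fun a _ => ⟨a.1.erase a.2, a.2⟩) (fun a _ => ⟨insert a.2 a.1, a.2⟩)
    ?_ ?_ ?_ ?_ ?_
  · rintro ⟨D, j⟩ ha
    simp only [mem_sigma, mem_powersetCard_univ, mem_compl] at ha ⊢
    exact ⟨by rw [card_erase_of_mem ha.2, ha.1, Nat.add_sub_cancel], notMem_erase j D⟩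
  · rintro ⟨D, j⟩ ha
    simp only [mem_sigma, mem_powersetCard_univ, mem_compl] at ha ⊢
    exact ⟨by rw [card_insert_of_notMem ha.2, ha.1], mem_insert_self j D⟩
  · rintro ⟨D, j⟩ ha
    simp only [mem_sigma, mem_powersetCard_univ] at ha
    simp [insert_erase ha.2]
  · rintro ⟨D, j⟩ ha
    simp only [mem_sigma, mem_powersetCard_univ, mem_compl] at ha
    simp [erase_insert ha.2]
  · rintro ⟨D, j⟩ _
    rfl

/-- Regroup the pairs (D, j) by E = `D.erase j`. The outcome law depends only on the size of D, so
for fixed E the capped false alarms can be summed over all j outside E, giving at most C. There are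
fewer sets E than sets D by a factor of at most 2 (m + 1) / n. -/
theorem sum_true_positive_le (p : Fin ℓ → unitInterval)
    (acc : Fin n → (Fin ℓ → Bool) → (Fin ℓ → Bool) → Bool) {m : ℕ} (hn : 2 * (m + 1) ≤ n)
    {C : ℝ} (hC : 0 ≤ C) {s : ℝ} (hs : 0 ≤ s) (τ : ℝ) :
    ∑ D ∈ powersetCard (m + 1) (univ : Finset (Fin n)), ∑ j ∈ D, ∑ X, designProb p X *
      (if acc j (X j) (testOutcome D X) = true ∧
        ∑ k ∈ (D.erase j)ᶜ, falseAlarm p acc (testOutcome D X) k ≤ C then 1 else 0) ≤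
    (m + 1) * (2 * C * Real.exp τ / n +
      Real.exp (-(s * τ)) * ∏ i, likelihoodMoment (p i) m s) * (n.choose (m + 1) : ℝ) := by
  set L := Real.exp (-(s * τ)) * ∏ i, likelihoodMoment (p i) m s with hL
  set h : Finset (Fin n) → Fin n → ℝ := fun D j => Real.exp τ * ∑ y, outcomesProb p (m + 1) y *
    (if ∑ k ∈ Dᶜ, falseAlarm p acc y k ≤ C then falseAlarm p acc y j else 0) with hh
  have hsum : ∀ D : Finset (Fin n), ∑ j ∈ Dᶜ, h D j ≤ Real.exp τ * C := by
    intro D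
    simp only [hh]
    rw [← mul_sum, sum_comm]
    refine mul_le_mul_of_nonneg_left ?_ (Real.exp_pos _).le
    calc _ = ∑ y, outcomesProb p (m + 1) y *
        (if ∑ k ∈ Dᶜ, falseAlarm p acc y k ≤ C then ∑ j ∈ Dᶜ, falseAlarm p acc y j else 0) := by
          refine sum_congr rfl fun y _ => ?_
          rw [← mul_sum]
          split_ifs <;> simp
      _ ≤ ∑ y, outcomesProb p (m + 1) y * C := by
          refine sum_le_sum fun y _ => mul_le_mul_of_nonneg_left ?_ (outcomesProb_nonneg p _ y)
          split_ifs with hy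
          · exact hy
          · exact hC
      _ = C := by rw [← sum_mul, sum_outcomesProb, one_mul]
  have hchoose : (n.choose m : ℝ) ≤ (m + 1) * 2 / n * n.choose (m + 1) := by
    have h1 : (n.choose (m + 1) : ℝ) * (m + 1) = n.choose m * (n - m) := by
      have := Nat.choose_succ_right_eq n m
      rw [← Nat.cast_sub (by omega)]
      exact_mod_cast this
    have hn' : (2 * (m + 1) : ℝ) ≤ n := by exact_mod_cast hn
    have hm : (0 : ℝ) ≤ m := m.cast_nonneg
    have hnpos : (0 : ℝ) < n := by linarith
    rw [div_mul_eq_mul_div, le_div_iff₀ hnpos]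
    have h2 : (0 : ℝ) ≤ n.choose m := Nat.cast_nonneg _
    nlinarith
  calc _ ≤ ∑ D ∈ powersetCard (m + 1) (univ : Finset (Fin n)), ∑ j ∈ D, (h (D.erase j) j + L) := by
        refine sum_le_sum fun D hD => sum_le_sum fun j hj => ?_
        exact true_positive_le p acc hj (mem_powersetCard_univ.1 hD) C hs τ
    _ = ∑ D ∈ powersetCard m (univ : Finset (Fin n)), ∑ j ∈ Dᶜ, h D j +
        n.choose (m + 1) * ((m + 1) * L) := by
        simp only [sum_add_distrib]
        rw [sum_powersetCard_erase]
        congr 1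
        rw [sum_congr rfl fun D hD => by
          rw [sum_const, mem_powersetCard_univ.1 hD], sum_const, card_powersetCard, card_univ,
          Fintype.card_fin, nsmul_eq_mul, nsmul_eq_mul]
        push_cast
        rfl
    _ ≤ n.choose m * (Real.exp τ * C) + n.choose (m + 1) * ((m + 1) * L) := by
        gcongr
        calc _ ≤ ∑ D ∈ powersetCard m (univ : Finset (Fin n)), Real.exp τ * C :=
              sum_le_sum fun D _ => hsum D
          _ = _ := by
              rw [sum_const, card_powersetCard, card_univ, Fintype.card_fin, nsmul_eq_mul]
    _ ≤ ((m + 1) * 2 / n * n.choose (m + 1)) * (Real.exp τ * C) +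
        n.choose (m + 1) * ((m + 1) * L) := by
        gcongr
    _ = _ := by ring

/-- A win occurs either despite many expected false alarms, or with at least 1 / κ true positives
under the cap; the latter is bounded by Markov's inequality. -/
theorem win_prob_given_bias_le (p : Fin ℓ → unitInterval)
    (acc : Fin n → (Fin ℓ → Bool) → (Fin ℓ → Bool) → Bool) {m : ℕ} (hn : 2 * (m + 1) ≤ n)
    (Win : Finset (Fin n) → Finset (Fin n) → Prop) [∀ D A, Decidable (Win D A)]
    {κ : ℝ} (hκ : 0 ≤ κ)
    (hWin : ∀ D A, #D = m + 1 → Win D A → A ⊆ D ∧ 1 ≤ κ * #A)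
    {C : ℝ} (hC : 0 ≤ C) {s : ℝ} (hs : 0 ≤ s) (τ : ℝ) :
    (∑ D ∈ powersetCard (m + 1) univ, ∑ X, designProb p X *
      (if Win D (univ.filter fun j => acc j (X j) (testOutcome D X) = true) then 1 else 0)) /
        (n.choose (m + 1) : ℝ) ≤
    Real.exp (-C) + κ * ((m + 1) * (2 * (C + 1) * Real.exp τ / n +
      Real.exp (-(s * τ)) * ∏ i, likelihoodMoment (p i) m s)) := by
  have hpos : (0 : ℝ) < n.choose (m + 1) := by
    exact_mod_cast Nat.choose_pos (by omega)
  rw [div_le_iff₀ hpos, add_mul, mul_assoc]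
  have hpt : ∀ D ∈ powersetCard (m + 1) (univ : Finset (Fin n)), ∀ X : Fin n → Fin ℓ → Bool,
      (if Win D (univ.filter fun j => acc j (X j) (testOutcome D X) = true)
        then (1 : ℝ) else 0) ≤
      (if (∀ j ∈ Dᶜ, ¬ acc j (X j) (testOutcome D X) = true) ∧
        C < ∑ j ∈ Dᶜ, falseAlarm p acc (testOutcome D X) j then 1 else 0) +
      κ * ∑ j ∈ D, (if acc j (X j) (testOutcome D X) = true ∧
        ∑ k ∈ (D.erase j)ᶜ, falseAlarm p acc (testOutcome D X) k ≤ C + 1 then 1 else 0) := by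
    intro D hD X
    have hsec : (0 : ℝ) ≤ ∑ j ∈ D, (if acc j (X j) (testOutcome D X) = true ∧
        ∑ k ∈ (D.erase j)ᶜ, falseAlarm p acc (testOutcome D X) k ≤ C + 1 then 1 else 0) :=
      sum_nonneg fun j _ => by split_ifs <;> norm_num
    have hsec' := mul_nonneg hκ hsec
    by_cases hw : Win D (univ.filter fun j => acc j (X j) (testOutcome D X) = true)
    swap
    · rw [if_neg hw]
      split_ifs <;> linarith
    rw [if_pos hw]
    obtain ⟨hsub, hcard⟩ := hWin D _ (mem_powersetCard_univ.1 hD) hw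
    have hno : ∀ j ∈ Dᶜ, ¬ acc j (X j) (testOutcome D X) = true := fun j hj ha =>
      mem_compl.1 hj (hsub (mem_filter.2 ⟨mem_univ j, ha⟩))
    by_cases hlt : C < ∑ j ∈ Dᶜ, falseAlarm p acc (testOutcome D X) j
    · rw [if_pos ⟨hno, hlt⟩]
      linarith
    · rw [if_neg fun h => hlt h.2, zero_add]
      refine hcard.trans (mul_le_mul_of_nonneg_left ?_ hκ)
      rw [card_eq_sum_ones, Nat.cast_sum]
      refine (sum_le_sum fun j hj => ?_).trans
        (sum_le_sum_of_subset_of_nonneg hsub fun j _ _ => by split_ifs <;> norm_num)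
      have hjD := hsub hj
      rw [if_pos, Nat.cast_one]
      refine ⟨(mem_filter.1 hj).2, ?_⟩
      -- Counting j as well adds a single false-alarm probability, at most 1; hence the cap C + 1.
      rw [compl_erase, sum_insert (by simpa using hjD)]
      linarith [falseAlarm_le_one p acc (testOutcome D X) j]
  calc _ ≤ ∑ D ∈ powersetCard (m + 1) (univ : Finset (Fin n)), (Real.exp (-C) +
        κ * ∑ j ∈ D, ∑ X, designProb p X * (if acc j (X j) (testOutcome D X) = true ∧
        ∑ k ∈ (D.erase j)ᶜ, falseAlarm p acc (testOutcome D X) k ≤ C + 1 then 1 else 0)) := by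
        refine sum_le_sum fun D hD => ?_
        refine (sum_le_sum fun X _ =>
          mul_le_mul_of_nonneg_left (hpt D hD X) (designProb_nonneg p X)).trans ?_
        simp only [mul_add, sum_add_distrib]
        refine add_le_add (no_false_positive_le p acc D C) (le_of_eq ?_)
        rw [sum_comm, mul_sum]
        refine sum_congr rfl fun X _ => ?_
        rw [← mul_sum]
        ring
    _ = Real.exp (-C) * n.choose (m + 1) + κ * ∑ D ∈ powersetCard (m + 1) (univ : Finset (Fin n)),
        ∑ j ∈ D, ∑ X, designProb p X * (if acc j (X j) (testOutcome D X) = true ∧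
        ∑ k ∈ (D.erase j)ᶜ, falseAlarm p acc (testOutcome D X) k ≤ C + 1 then 1 else 0) := by
        rw [sum_add_distrib, ← mul_sum, sum_const, card_powersetCard, card_univ, Fintype.card_fin,
          nsmul_eq_mul, mul_comm]
    _ ≤ _ := by
        gcongr
        exact sum_true_positive_le p acc hn (by linarith) hs τ

theorem winProb_le (S : SimpleGroupTesting n ℓ) (c : ℕ)
    (Win : Finset (Fin n) → Finset (Fin n) → Prop) [∀ D A, Decidable (Win D A)] {b : ℝ}
    (h : ∀ ω, (∑ D ∈ powersetCard c univ, ∑ X : Fin n → Fin ℓ → Bool, designProb (S.bias ω) X *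
        (if Win D (S.accused ω X (testOutcome D X)) then 1 else 0)) / (n.choose c : ℝ) ≤ b) :
    S.winProb c Win ≤ b := by
  let := S.measurableSpace
  have := S.isProbabilityMeasure
  calc S.winProb c Win ≤ ∫ _, b ∂S.law := by
        -- As the integrand is nonnegative, only the constant bound has to be integrable.
        refine MeasureTheory.integral_mono_of_nonneg (Filter.Eventually.of_forall fun ω => ?_)
          (MeasureTheory.integrable_const b) (Filter.Eventually.of_forall h)
        refine div_nonneg (sum_nonneg fun D _ => sum_nonneg fun X _ =>
          mul_nonneg (designProb_nonneg _ X) ?_) (Nat.cast_nonneg _)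
        split_ifs <;> norm_num
    _ = b := by simp

/-! ### Choice of the parameters -/

/-- `hsδ` and `hmδ` make each of the two error terms of `likelihoodMoment_le` at most half of δ
times the main term. -/
theorem prod_likelihoodMoment_le {δ s : ℝ} (hs : 0 < s) (hs' : s ≤ 1 / 2)
    (hsδ : 64 * s ≤ δ * Real.log 2 ^ 2) {m : ℕ} (hm : m ≠ 0)
    (hmδ : 10 ≤ δ * Real.log 2 ^ 2 * (m + 1)) (p : Fin ℓ → unitInterval) :
    ∏ i, likelihoodMoment (p i) m s ≤
      Real.exp (s * (1 + δ) * (ℓ * Real.log 2 ^ 2 / (m + 1))) := by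
  have h : ∀ i, likelihoodMoment (p i) m s ≤
      Real.exp (s * (1 + δ) * (Real.log 2 ^ 2 / (m + 1))) := by
    intro i
    refine (likelihoodMoment_le (p i).2.1 (p i).2.2 hs hs' hm).trans ?_
    have h1 : 32 * s ^ 2 ≤ s * (δ * Real.log 2 ^ 2 / 2) := by nlinarith
    have h2 : 5 * s / (m + 1 : ℝ) ^ 2 ≤ s * (δ * Real.log 2 ^ 2 / 2) / (m + 1) := by
      rw [div_le_div_iff₀ (by positivity) (by positivity)]
      have : 0 ≤ s * (m + 1) := by positivity
      nlinarith
    have h3 : (s * Real.log 2 ^ 2 + 32 * s ^ 2) / (m + 1 : ℝ) ≤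
        (s * Real.log 2 ^ 2 + s * (δ * Real.log 2 ^ 2 / 2)) / (m + 1) := by gcongr
    calc _ ≤ 1 + (s * Real.log 2 ^ 2 + s * (δ * Real.log 2 ^ 2 / 2)) / (m + 1 : ℝ) +
          s * (δ * Real.log 2 ^ 2 / 2) / (m + 1) := by gcongr
      _ = s * (1 + δ) * (Real.log 2 ^ 2 / (m + 1)) + 1 := by ring
      _ ≤ _ := Real.add_one_le_exp _
  calc ∏ i, likelihoodMoment (p i) m s
      ≤ ∏ _i : Fin ℓ, Real.exp (s * (1 + δ) * (Real.log 2 ^ 2 / (m + 1))) := by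
        refine prod_le_prod (fun i _ => ?_) fun i _ => h i
        refine sum_nonneg fun x _ => sum_nonneg fun y _ => ?_
        have h1 := jointProb_nonneg (p i).2.1 (p i).2.2 m x y
        have h2 := itemProb_nonneg (p i).2.1 (p i).2.2 x
        have h3 := outcomeProb_nonneg (p i).2.1 (p i).2.2 (m + 1) y
        positivity
    _ = _ := by
        rw [prod_const, card_univ, Fintype.card_fin, ← Real.exp_nat_mul]
        congr 1
        ring

/-- With too few tests, a defective item is declared defective with probability at most
polynomially small in `n`. -/
theorem exists_error_exponent {δ C : ℝ} (hδ : 0 < δ) (hδ1 : δ < 1) (hC : 0 ≤ C) :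
    ∃ γ > (0 : ℝ), ∃ B > (0 : ℝ), ∃ c₁ : ℕ, ∀ m n ℓ : ℕ, c₁ ≤ m + 1 → m ≠ 0 → 2 * (m + 1) ≤ n →
      (ℓ : ℝ) < (1 - δ) * ((m + 1 : ℕ) * Real.log n / Real.log 2 ^ 2) →
      ∃ s τ : ℝ, 0 ≤ s ∧ ∀ p : Fin ℓ → unitInterval,
        2 * (C + 1) * Real.exp τ / n +
          Real.exp (-(s * τ)) * ∏ i, likelihoodMoment (p i) m s ≤ B * (n : ℝ) ^ (-γ) := by
  have hl : 0 < Real.log 2 := Real.log_pos (by norm_num)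
  have hl1 : Real.log 2 < 1 := by linarith [Real.log_two_lt_d9]
  set s := δ * Real.log 2 ^ 2 / 64 with hs
  have hs0 : 0 < s := by positivity
  have hs1 : s ≤ 1 / 2 := by
    have : δ * Real.log 2 ^ 2 ≤ 1 * 1 ^ 2 := by gcongr
    rw [hs]
    linarith
  refine ⟨s * δ ^ 2 / 2, by positivity, 2 * (C + 1) + 1, by positivity,
    ⌈10 / (δ * Real.log 2 ^ 2)⌉₊, fun m n ℓ hm hm0 hn hℓ => ?_⟩
  have hmδ : 10 ≤ δ * Real.log 2 ^ 2 * (m + 1) := by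
    have := Nat.ceil_le.1 hm
    rw [div_le_iff₀ (by positivity)] at this
    push_cast at this
    linarith
  have hn1 : (1 : ℝ) ≤ n := by exact_mod_cast (by omega : 1 ≤ n)
  have hn0 : (0 : ℝ) < n := by linarith
  set N := Real.log n with hN
  have hN0 : 0 ≤ N := Real.log_nonneg hn1
  have hexpN : (n : ℝ) = Real.exp N := (Real.exp_log hn0).symm
  have hpow : (n : ℝ) ^ (-(s * δ ^ 2 / 2)) = Real.exp (-(s * δ ^ 2 / 2) * N) := by
    rw [Real.rpow_def_of_pos hn0, mul_comm]
  -- The moments contribute at most s (1 + δ) (1 - δ) N = s (1 - δ²) N to the exponent. Placing τ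
  -- midway between (1 - δ²) N and N leaves a gain of δ²/2 in both terms.
  refine ⟨s, (1 - δ ^ 2 / 2) * N, hs0.le, fun p => ?_⟩
  have hprod := prod_likelihoodMoment_le hs0 hs1 (by rw [hs]; linarith) hm0 hmδ p
  have hℓ' : (ℓ : ℝ) * Real.log 2 ^ 2 / (m + 1) ≤ (1 - δ) * N := by
    rw [div_le_iff₀ (by positivity)]
    push_cast at hℓ
    rw [← mul_div_assoc, lt_div_iff₀ (by positivity)] at hℓ
    linarith
  rw [hpow, add_mul]
  refine add_le_add ?_ ?_
  · rw [mul_div_assoc, hexpN, ← Real.exp_sub]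
    refine mul_le_mul_of_nonneg_left (Real.exp_le_exp.2 ?_) (by positivity)
    have : 0 ≤ δ ^ 2 * N := by positivity
    nlinarith
  · rw [one_mul]
    refine (mul_le_mul_of_nonneg_left hprod (Real.exp_pos _).le).trans ?_
    rw [← Real.exp_add]
    refine Real.exp_le_exp.2 ?_
    have := mul_le_mul_of_nonneg_left hℓ' (show 0 ≤ s * (1 + δ) by positivity)
    linarith

/-- The cap C = log (2 / η) makes the first error term exp (-C) equal to η / 2. -/
theorem winProb_bound {δ η : ℝ} (hδ : 0 < δ) (hδ1 : δ < 1) (hη : 0 < η) (hη1 : η < 1) :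
    ∃ γ > (0 : ℝ), ∃ B > (0 : ℝ), ∃ c₁ : ℕ, ∀ m n ℓ : ℕ, c₁ ≤ m + 1 → m ≠ 0 → 2 * (m + 1) ≤ n →
      (ℓ : ℝ) < (1 - δ) * ((m + 1 : ℕ) * Real.log n / Real.log 2 ^ 2) →
      ∀ (S : SimpleGroupTesting n ℓ) (Win : Finset (Fin n) → Finset (Fin n) → Prop)
        [∀ D A, Decidable (Win D A)] (κ : ℝ), 0 ≤ κ →
        (∀ D A, #D = m + 1 → Win D A → A ⊆ D ∧ 1 ≤ κ * #A) →
        S.winProb (m + 1) Win ≤ η / 2 + κ * (m + 1) * (B * (n : ℝ) ^ (-γ)) := by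
  have hC : 0 ≤ Real.log (2 / η) := Real.log_nonneg (by rw [le_div_iff₀ hη]; linarith)
  obtain ⟨γ, hγ, B, hB, c₁, h⟩ := exists_error_exponent hδ hδ1 hC
  refine ⟨γ, hγ, B, hB, c₁, fun m n ℓ hm hm0 hn hℓ S Win _ κ hκ hWin => ?_⟩
  obtain ⟨s, τ, hs, hp⟩ := h m n ℓ hm hm0 hn hℓ
  refine winProb_le S _ _ fun ω => ?_
  refine (win_prob_given_bias_le (S.bias ω) (S.accuse ω) hn Win hκ hWin hC hs τ).trans ?_
  rw [Real.exp_neg, Real.exp_log (by positivity), inv_div, ← mul_assoc κ]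
  gcongr
  exact hp _

end GroupTesting

/-! ### Numerical constant and conclusion -/

theorem abs_one_div_log_two_sq_sub_lt : |1 / Real.log 2 ^ 2 - 2.08| < 0.005 := by
  have h1 := Real.log_two_gt_d9
  have h2 := Real.log_two_lt_d9
  have h3 : 0 < Real.log 2 ^ 2 := by positivity
  rw [abs_lt, lt_sub_iff_add_lt, sub_lt_iff_lt_add, lt_div_iff₀ h3, div_lt_iff₀ h3]
  constructor <;> nlinarith

theorem corollary1 :
    -- finding all defectives
    (∀ δ ε : ℝ, 0 < δ → 0 < ε → ε < 1 →
      ∃ c₀ : ℕ, ∀ c n ℓ : ℕ, c₀ ≤ c → 2 * c ≤ n →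
        ∀ S : SimpleGroupTesting n ℓ, 1 - ε ≤ S.probFindAll c →
          (1 - δ) * (c * Real.log n / Real.log 2 ^ 2) ≤ ℓ) ∧
    -- finding at least one defective, without false positives
    (∀ δ ε : ℝ, 0 < δ → 0 < ε → ε < 1 →
      ∃ c₀ K : ℕ, ∀ c n ℓ : ℕ, c₀ ≤ c → c ^ K ≤ n →
        ∀ S : SimpleGroupTesting n ℓ, 1 - ε ≤ S.probFindSome c →
          (1 - δ) * (c * Real.log n / Real.log 2 ^ 2) ≤ ℓ) ∧
    -- the numerical value of the constant
    |1 / Real.log 2 ^ 2 - 2.08| < 0.005 := by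
  have trivial_bound : ∀ {δ : ℝ}, 1 ≤ δ → ∀ c n ℓ : ℕ,
      (1 - δ) * (c * Real.log n / Real.log 2 ^ 2) ≤ ℓ := by
    intro δ hδ c n ℓ
    have h : 0 ≤ c * Real.log n / Real.log 2 ^ 2 :=
      div_nonneg (mul_nonneg (Nat.cast_nonneg _) (Real.log_natCast_nonneg n)) (sq_nonneg _)
    exact (mul_nonpos_of_nonpos_of_nonneg (by linarith) h).trans (Nat.cast_nonneg _)
  refine ⟨fun δ ε hδ hε hε1 => ?_, fun δ ε hδ hε hε1 => ?_, abs_one_div_log_two_sq_sub_lt⟩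
  · rcases le_or_gt 1 δ with hδ1 | hδ1
    · exact ⟨0, fun c n ℓ _ _ _ _ => trivial_bound hδ1 c n ℓ⟩
    obtain ⟨γ, hγ, B, hB, c₁, h⟩ := GroupTesting.winProb_bound hδ hδ1
      (show 0 < 1 - ε by linarith) (by linarith)
    have hlim : Filter.Tendsto (fun n : ℕ => B * (n : ℝ) ^ (-γ)) Filter.atTop (nhds 0) := by
      simpa using ((tendsto_rpow_neg_atTop hγ).comp tendsto_natCast_atTop_atTop).const_mul B
    obtain ⟨N, hN⟩ := Filter.eventually_atTop.1
      (hlim.eventually_lt_const (show 0 < (1 - ε) / 2 by linarith))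
    refine ⟨max (max c₁ N) 2, fun c n ℓ hc hn S hS => ?_⟩
    simp only [max_le_iff] at hc
    obtain ⟨m, rfl⟩ : ∃ m, c = m + 1 := ⟨c - 1, by omega⟩
    by_contra! hℓ
    -- All m + 1 defectives are accused, so κ = 1 / (m + 1) cancels the factor m + 1 and n ≥ 2c
    -- suffices.
    have hwin := h m n ℓ hc.1.1 (by omega) hn hℓ S (fun D A => A = D) (1 / (m + 1))
      (by positivity) fun D A hD hA => ⟨hA.subset, by
        rw [hA, hD]
        push_cast
        rw [one_div_mul_cancel (by positivity)]⟩
    rw [one_div_mul_cancel (by positivity), one_mul] at hwin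
    have hlt := hN n (by omega)
    rw [SimpleGroupTesting.probFindAll] at hS
    linarith
  · rcases le_or_gt 1 δ with hδ1 | hδ1
    · exact ⟨0, 0, fun c n ℓ _ _ _ _ => trivial_bound hδ1 c n ℓ⟩
    obtain ⟨γ, hγ, B, hB, c₁, h⟩ := GroupTesting.winProb_bound hδ hδ1
      (show 0 < 1 - ε by linarith) (by linarith)
    -- Here κ = 1 and the factor c survives. The exponent 2 / γ gives n^(-γ) ≤ c^(-2), leaving B /
    -- c, which the lower bound on c makes smaller than (1 - ε) / 2; the extra 2 in the exponent
    -- ensures n ≥ 2c.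
    refine ⟨max (max c₁ (⌈2 * B / (1 - ε)⌉₊ + 1)) 2, ⌈2 / γ⌉₊ + 2, fun c n ℓ hc hn S hS => ?_⟩
    simp only [max_le_iff] at hc
    obtain ⟨m, rfl⟩ : ∃ m, c = m + 1 := ⟨c - 1, by omega⟩
    have hn2 : 2 * (m + 1) ≤ n := by
      calc 2 * (m + 1) ≤ (m + 1) * (m + 1) := Nat.mul_le_mul_right _ hc.2
        _ = (m + 1) ^ 2 := (sq _).symm
        _ ≤ (m + 1) ^ (⌈2 / γ⌉₊ + 2) := Nat.pow_le_pow_right (by omega) (by omega)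
        _ ≤ n := hn
    by_contra! hℓ
    have hwin := h m n ℓ hc.1.1 (by omega) hn2 hℓ S (fun D A => A.Nonempty ∧ A ⊆ D) 1
      zero_le_one fun D A _ hA => ⟨hA.2, by
        rw [one_mul]
        exact_mod_cast hA.1.card_pos⟩
    rw [SimpleGroupTesting.probFindSome] at hS
    have hc0 : (1 : ℝ) ≤ (m + 1 : ℝ) := by linarith [(Nat.cast_nonneg m : (0 : ℝ) ≤ m)]
    have hpow : (n : ℝ) ^ (-γ) ≤ ((m + 1 : ℝ) ^ 2)⁻¹ := by
      have hn' : ((m + 1 : ℝ)) ^ (⌈2 / γ⌉₊ + 2) ≤ n := by exact_mod_cast hn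
      rw [Real.rpow_neg (Nat.cast_nonneg n)]
      gcongr
      calc (m + 1 : ℝ) ^ 2 = (m + 1 : ℝ) ^ (2 : ℝ) := by norm_cast
        _ ≤ (m + 1 : ℝ) ^ (((⌈2 / γ⌉₊ + 2 : ℕ) : ℝ) * γ) := by
            refine Real.rpow_le_rpow_of_exponent_le hc0 ?_
            rw [← div_le_iff₀ hγ]
            push_cast
            linarith [Nat.le_ceil (2 / γ)]
        _ = ((m + 1 : ℝ) ^ (⌈2 / γ⌉₊ + 2)) ^ γ := by
            rw [Real.rpow_mul (by positivity), Real.rpow_natCast]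
        _ ≤ (n : ℝ) ^ γ := by gcongr
    have hBc : 2 * B < (1 - ε) * (m + 1) := by
      have h1 : ((⌈2 * B / (1 - ε)⌉₊ + 1 : ℕ) : ℝ) ≤ ((m + 1 : ℕ) : ℝ) := by
        exact_mod_cast hc.1.2
      push_cast at h1
      have h2 : 2 * B / (1 - ε) < m + 1 := by linarith [Nat.le_ceil (2 * B / (1 - ε))]
      rw [div_lt_iff₀ (by linarith)] at h2
      linarith
    have hfin : 1 * (m + 1 : ℝ) * (B * (n : ℝ) ^ (-γ)) < (1 - ε) / 2 := by
      calc 1 * (m + 1 : ℝ) * (B * (n : ℝ) ^ (-γ))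
          ≤ 1 * (m + 1 : ℝ) * (B * ((m + 1 : ℝ) ^ 2)⁻¹) := by gcongr
        _ = B / (m + 1) := by field_simp
        _ < (1 - ε) / 2 := by
            rw [div_lt_iff₀ (by positivity)]
            linarith
    linarith
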